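/- Model. Asynchronous processes communicate by applying atomic operations to shared objects; an algorithm may use any number (possibly infinitely many) of objects of a given type $T$ together with read/write registers, each initialized to a state chosen by the algorithm. The type $\mathrm{stack}$ has as states the finite sequences over a non-empty set $V$, with operations $\mathrm{Push}(v)$ (adds $v\in V$ on top and returns an acknowledgement) and $\mathrm{Pop}$ (removes and returns the top element, or returns $\mathrm{empty}$ if the sequence is empty). In the independent crash model, each process may at any time, individually, crash and recover: its local memory is reset and it executes its code again from the beginning with the same input, while shared objects keep their states. An algorithm in which each process has an input from a set $D$ with at least two elements solves *recoverable consensus* (RC) if every execution satisfies: (agreement) no two outputs are different, including outputs of the same process in different runs; (validity) each output is the input of some process; (recoverable wait-freedom) a process that executes its code from the beginning crashes or outputs a value after finitely many of its own steps. It solves (wait-free) *consensus* if these properties hold in all executions without crash-recovery (where processes may simply halt). Let $\mathrm{rcons}(T)$ (resp. $\mathrm{cons}(T)$) be the maximum number $n$ of processes for which RC with independent crashes (resp. consensus) can be solved using objects of type $T$ and registers, or $\infty$ if there is no maximum. Theorem. Two processes cannot solve recoverable consensus with independent crashes using stacks and registers. Hence $\mathrm{rcons}(\mathrm{stack})=1$,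 whereas $\mathrm{cons}(\mathrm{stack})=2$. (This holds for every non-empty set $V$ of stack elements and every input set $D$ with at least two elements.) -/

import Mathlib

universe u

namespace SharedMemory

/-- A deterministic shared object type, given by its sequential specification: applying an
operation to an object in a given state yields a unique new state and response. -/
structure ObjType where
  State : Type u
  Op : Type u
  Resp : Type u
  apply : State → Op → State × Resp

inductive StackOp (V : Type u) : Type u
  | push (v : V)
  | pop

inductive StackResp (V : Type u) : Type u
  | ack
  | popped (v : V)
  | empty

/-- The stack type with elements from `V`.  The head of the list is the top of the stack;
popping an empty stack leaves it empty and returns `empty`. -/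
def stack (V : Type u) : ObjType.{u} where
  State := List V
  Op := StackOp V
  Resp := StackResp V
  apply
    | s, .push v => (v :: s, .ack)
    | [], .pop => ([], .empty)
    | v :: s, .pop => (s, .popped v)

inductive RegOp (W : Type u) : Type u
  | read
  | write (w : W)

inductive RegResp (W : Type u) : Type u
  | ack
  | value (w : W)

/-- The read/write register type with values from `W`. -/
def register (W : Type u) : ObjType.{u} where
  State := W
  Op := RegOp W
  Resp := RegResp W
  apply
    | s, .read => (s, .value s)
    | _, .write w => (w, .ack)

/-- What a process does next, as prescribed by its code in its current local state: output a
value (which ends its current run), or apply an operation atomically to a shared object and move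
to a new local state that depends on the response. -/
inductive Action (T R : ObjType.{u}) (Obj Reg Loc D : Type u) : Type u
  | output (v : D)
  | onObj (o : Obj) (op : T.Op) (k : T.Resp → Loc)
  | onReg (r : Reg) (op : R.Op) (k : R.Resp → Loc)

/-- An algorithm for `n` processes with inputs and outputs in `D`, using shared objects of type
`T` and registers.  There may be infinitely many shared objects, each with an initial state chosen
by the algorithm.  `init p x` is the state of the local memory (with the program counter) of
process `p` at the beginning of its code, when its input is `x`. -/
structure Algorithm (T : ObjType.{u}) (n : ℕ) (D : Type u) where
  Obj : Type u
  objInit : Obj → T.State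
  Reg : Type u
  RegVal : Type u
  regInit : Reg → RegVal
  Loc : Type u
  init : Fin n → D → Loc
  next : Fin n → Loc → Action T (register RegVal) Obj Reg Loc D

/-- Events of an execution: a process takes the next step of its code, or it crashes. -/
inductive Event (n : ℕ) : Type
  | step (p : Fin n)
  | crash (p : Fin n)

/-- An infinite sequence of events.  (Finite executions are the prefixes.  A process
may cease taking steps at any time.) -/
abbrev Schedule (n : ℕ) : Type := ℕ → Event n

namespace Algorithm

variable {T : ObjType.{u}} {n : ℕ} {D : Type u}

/-- A configuration: local states of all processes (volatile) and states of all shared objects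
(non-volatile). -/
structure Config (A : Algorithm T n D) where
  loc : Fin n → A.Loc
  obj : A.Obj → T.State
  reg : A.Reg → A.RegVal

def initial (A : Algorithm T n D) (inp : Fin n → D) : A.Config where
  loc p := A.init p (inp p)
  obj := A.objInit
  reg := A.regInit

open Classical in
/-- The effect of one event.  A step of a process that has already output a value in its current
run does nothing.  A crash of `p` resets the local state of `p`, so that `p` will execute
its code again from the beginning with the same input; shared objects are unaffected. -/
noncomputable def exec (A : Algorithm T n D) (inp : Fin n → D) (c : A.Config) :
    Event n → A.Config
  | .step p =>
    match A.next p (c.loc p) with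
    | .output _ => c
    | .onObj o op k =>
      { loc := Function.update c.loc p (k (T.apply (c.obj o) op).2)
        obj := Function.update c.obj o (T.apply (c.obj o) op).1
        reg := c.reg }
    | .onReg r op k =>
      { loc := Function.update c.loc p (k ((register A.RegVal).apply (c.reg r) op).2)
        obj := c.obj
        reg := Function.update c.reg r ((register A.RegVal).apply (c.reg r) op).1 }
  | .crash p => { c with loc := Function.update c.loc p (A.init p (inp p)) }

/-- The configuration after the first `t` events of the schedule `σ`. -/
noncomputable def configAt (A : Algorithm T n D) (inp : Fin n → D) (σ : Schedule n) :
    ℕ → A.Config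
  | 0 => A.initial inp
  | t + 1 => A.exec inp (A.configAt inp σ t) (σ t)

/-- In the configuration reached after `t` events, process `p` has output `v` in its current
run. -/
def Outputs (A : Algorithm T n D) (inp : Fin n → D) (σ : Schedule n) (t : ℕ) (p : Fin n)
    (v : D) : Prop :=
  A.next p ((A.configAt inp σ t).loc p) = .output v

/-- No two outputs produced are different, whether by different processes or by the same process
in different runs. -/
def Agreement (A : Algorithm T n D) (inp : Fin n → D) (σ : Schedule n) : Prop :=
  ∀ t t' p p' v v', A.Outputs inp σ t p v → A.Outputs inp σ t' p' v' → v = v'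

/-- Each output is the input of some process. -/
def Validity (A : Algorithm T n D) (inp : Fin n → D) (σ : Schedule n) : Prop :=
  ∀ t p v, A.Outputs inp σ t p v → ∃ q, inp q = v

/-- (Recoverable) wait-freedom: a process that does not crash from some time on and that takes
infinitely many steps outputs a value after that time. -/
def WaitFree (A : Algorithm T n D) (inp : Fin n → D) (σ : Schedule n) : Prop :=
  ∀ p t₀, (∀ t, t₀ ≤ t → σ t ≠ .crash p) → (∀ s, ∃ t, s ≤ t ∧ σ t = .step p) →
    ∃ t v, t₀ ≤ t ∧ A.Outputs inp σ t p v

/-- `A` solves recoverable consensus with independent crashes: the three properties hold in all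
executions, where processes crash and recover individually at arbitrary times. -/
def SolvesRC (A : Algorithm T n D) : Prop :=
  ∀ inp σ, A.Agreement inp σ ∧ A.Validity inp σ ∧ A.WaitFree inp σ

/-- `A` solves standard wait-free consensus: the three properties hold in all executions without
crash-recovery events (a halting failure is a process that takes no more steps). -/
def SolvesConsensus (A : Algorithm T n D) : Prop :=
  ∀ inp σ, (∀ t p, σ t ≠ .crash p) →
    A.Agreement inp σ ∧ A.Validity inp σ ∧ A.WaitFree inp σ

end Algorithm

/-- Recoverable consensus among `n` processes with inputs from `D` is solvable using objects of
type `T` and registers, with independent crashes. -/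
def RCSolvable (T : ObjType.{u}) (D : Type u) (n : ℕ) : Prop :=
  ∃ A : Algorithm T n D, A.SolvesRC

/-- Wait-free consensus among `n` processes with inputs from `D` is solvable using objects of
type `T` and registers. -/
def ConsensusSolvable (T : ObjType.{u}) (D : Type u) (n : ℕ) : Prop :=
  ∃ A : Algorithm T n D, A.SolvesConsensus

/-- The independent RC number: the maximum number of processes that can solve RC using objects of
type `T` and registers, or `⊤` if there is no maximum. -/
noncomputable def rcons (T : ObjType.{u}) (D : Type u) : ℕ∞ :=
  sSup {m : ℕ∞ | ∃ n : ℕ, m = n ∧ RCSolvable T D n}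

/-- The consensus number: the maximum number of processes that can solve consensus using objects
of type `T` and registers, or `⊤` if there is no maximum. -/
noncomputable def cons (T : ObjType.{u}) (D : Type u) : ℕ∞ :=
  sSup {m : ℕ∞ | ∃ n : ℕ, m = n ∧ ConsensusSolvable T D n}

end SharedMemory

/-! Both upper bounds are valency arguments at a critical execution, after which a step of `p` and a
step of `q` lead to different decisions. By `step_conflict`, either one of the two processes cannot
tell whether the other one stepped before it, and its solo run gives a contradiction, or the two
orders leave the shared objects equal except for `k` elements on top of a single stack. Two pushes
give `k = 2`, a push and a successful pop give `k = 1`, and all remaining conflicts give `k = 0`. In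
each case at least `k` of the two processes received the same response in both orders.

Suppose that a process has the same local state in both configurations and runs alone. Either it
outputs the same value in both, or it pops an element of the differing block, which then shrinks by
one (`near_run_solo`). So `k + 1` such runs force a common output. Without crashes, a third process
and the `k` processes that do not notice the order provide these runs (`eq_of_near`). With crashes,
`q` alone suffices: each crash makes its local states equal again (`eq_of_near_of_crashes`).

The delicate point with crashes is that a critical execution must exist, although wait-freedom
promises nothing to a process that crashes forever. Therefore `p` never crashes, and the
continuations that define valency let `q` crash only after a step of `p` (`CrashAfterStep`). As `p`
does not see crashes of `q`, the value fixed by the step of `p` at the critical execution survives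
them (`exists_value_of_crashes`).

For the lower bounds, one process outputs its input, and two crash-free processes compete for the
only element of a stack. -/

namespace SharedMemory

namespace Algorithm

/-! ### Finite executions and their relation to infinite schedules -/

section Executions

variable {T : ObjType.{u}} {n : ℕ} {D : Type u}

/-- The configuration reached from `c` by a finite sequence of events. -/
noncomputable def run (A : Algorithm T n D) (inp : Fin n → D) (c : A.Config)
    (w : List (Event n)) : A.Config :=
  w.foldl (A.exec inp) c

/-- The configuration reached by the finite execution `h`. -/
noncomputable def after (A : Algorithm T n D) (inp : Fin n → D) (h : List (Event n)) : A.Config :=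
  A.run inp (A.initial inp) h

/-- In the configuration `c`, process `p` has output `v` in its current run. -/
def OutputsIn (A : Algorithm T n D) (c : A.Config) (p : Fin n) (v : D) : Prop :=
  A.next p (c.loc p) = .output v

/-- The first `t` events of a schedule. -/
def firstEvents (σ : Schedule n) (t : ℕ) : List (Event n) := (List.range t).map σ

/-- The schedule that starts with `h` and continues with steps of `p` only. -/
def extendBy (h : List (Event n)) (p : Fin n) : Schedule n := fun t => (h[t]?).getD (.step p)

/-- Solvability of consensus in all executions that consist of events in `F`. -/
def SolvesUnder (A : Algorithm T n D) (F : Event n → Prop) : Prop :=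
  ∀ inp σ, (∀ t, F (σ t)) → A.Agreement inp σ ∧ A.Validity inp σ ∧ A.WaitFree inp σ

variable {A : Algorithm T n D} {inp : Fin n → D}

@[simp] theorem run_nil (c : A.Config) : A.run inp c [] = c := rfl

@[simp] theorem run_cons (c : A.Config) (e : Event n) (w : List (Event n)) :
    A.run inp c (e :: w) = A.run inp (A.exec inp c e) w := rfl

theorem run_append (c : A.Config) (w w' : List (Event n)) :
    A.run inp c (w ++ w') = A.run inp (A.run inp c w) w' := List.foldl_append ..

theorem after_append (h w : List (Event n)) :
    A.after inp (h ++ w) = A.run inp (A.after inp h) w := run_append ..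

theorem configAt_eq_after (σ : Schedule n) (t : ℕ) :
    A.configAt inp σ t = A.after inp (firstEvents σ t) := by
  induction t with
  | zero => rfl
  | succ t ih =>
    rw [configAt, ih, firstEvents, firstEvents, List.range_succ, List.map_append, after_append]
    rfl

theorem firstEvents_extendBy_le (h w : List (Event n)) (p : Fin n) :
    firstEvents (extendBy (h ++ w) p) h.length = h := by
  apply List.ext_getElem
  · simp [firstEvents]
  · intro i h1 h2
    simp [firstEvents, extendBy, List.getElem?_append_left h2, List.getElem?_eq_getElem h2]

theorem firstEvents_extendBy_add (h : List (Event n)) (p : Fin n) (j : ℕ) :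
    firstEvents (extendBy h p) (h.length + j) = h ++ List.replicate j (.step p) := by
  apply List.ext_getElem
  · simp [firstEvents]
  · intro i h1 h2
    by_cases hi : i < h.length
    · simp [firstEvents, extendBy, List.getElem_append_left hi, List.getElem?_eq_getElem hi]
    · simp [firstEvents, extendBy, List.getElem_append_right (not_lt.mp hi),
        List.getElem?_eq_none (not_lt.mp hi)]

theorem extendBy_mem {F : Event n → Prop} {h : List (Event n)} {p : Fin n}
    (hF : ∀ e ∈ h, F e) (hp : F (.step p)) (t : ℕ) : F (extendBy h p t) := by
  unfold extendBy
  rcases lt_or_ge t h.length with ht | ht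
  · rw [List.getElem?_eq_getElem ht]
    exact hF _ (List.getElem_mem ht)
  · rwa [List.getElem?_eq_none ht]

section Solves

variable {F : Event n → Prop}

/-- The consensus properties are stated for infinite schedules. Completing a finite execution by
steps of one process (`extendBy`) makes them available for finite executions, here and in the next
two lemmas. -/
theorem SolvesUnder.agree (hA : A.SolvesUnder F) (hs : ∀ p, F (.step p)) {h w : List (Event n)}
    (hF : ∀ e ∈ h ++ w, F e) {p q : Fin n} {v v' : D} (ho : A.OutputsIn (A.after inp h) p v)
    (ho' : A.OutputsIn (A.after inp (h ++ w)) q v') : v = v' := by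
  refine (hA inp _ (extendBy_mem hF (hs p))).1 h.length (h ++ w).length p q v v' ?_ ?_
  · rwa [Outputs, configAt_eq_after, firstEvents_extendBy_le]
  · have := firstEvents_extendBy_add (h ++ w) p 0
    rw [add_zero, List.replicate_zero, List.append_nil] at this
    rwa [Outputs, configAt_eq_after, this]

theorem SolvesUnder.valid (hA : A.SolvesUnder F) (hs : ∀ p, F (.step p)) {h : List (Event n)}
    (hF : ∀ e ∈ h, F e) {p : Fin n} {v : D} (ho : A.OutputsIn (A.after inp h) p v) :
    ∃ q, inp q = v := by
  refine (hA inp _ (extendBy_mem hF (hs p))).2.1 h.length p v ?_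
  have := firstEvents_extendBy_add h p 0
  rw [add_zero, List.replicate_zero, List.append_nil] at this
  rwa [Outputs, configAt_eq_after, this]

theorem SolvesUnder.solo (hA : A.SolvesUnder F) (hs : ∀ p, F (.step p)) {h : List (Event n)}
    (hF : ∀ e ∈ h, F e) (p : Fin n) :
    ∃ j v, A.OutputsIn (A.after inp (h ++ List.replicate j (.step p))) p v := by
  have hstep : ∀ t, h.length ≤ t → extendBy h p t = .step p := fun t ht => by
    simp [extendBy, List.getElem?_eq_none ht]
  obtain ⟨t, v, ht, ho⟩ := (hA inp _ (extendBy_mem hF (hs p))).2.2 p h.length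
    (fun t ht => by simp [hstep t ht])
    (fun s => ⟨max s h.length, le_max_left .., hstep _ (le_max_right ..)⟩)
  obtain ⟨j, rfl⟩ := Nat.exists_eq_add_of_le ht
  exact ⟨j, v, by rwa [Outputs, configAt_eq_after, firstEvents_extendBy_add] at ho⟩

end Solves

/-- Extending a good execution again and again by a move from `M` yields an infinite schedule. -/
theorem exists_schedule_of_extendable {Good : List (Event n) → Prop} {M : Set (List (Event n))}
    (h0 : Good []) (hne : ∀ m ∈ M, m ≠ [])
    (hext : ∀ h, Good h → ∃ m ∈ M, Good (h ++ m)) :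
    ∃ σ : Schedule n, (∀ t, ∃ m ∈ M, σ t ∈ m) ∧
      (∀ s, ∃ t, s ≤ t ∧ Good (firstEvents σ t)) ∧
      ∀ s, ∃ t, s ≤ t ∧ ∃ m ∈ M, firstEvents σ (t + m.length) = firstEvents σ t ++ m := by
  choose! f hfM hfG using hext
  let L : ℕ → List (Event n) := fun i => Nat.rec [] (fun _ h => h ++ f h) i
  have hL : ∀ i, L (i + 1) = L i ++ f (L i) := fun i => rfl
  have hG : ∀ i, Good (L i) := fun i => by
    induction i with
    | zero => exact h0
    | succ i ih => rw [hL]; exact hfG _ ih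
  have hlen : ∀ i, i ≤ (L i).length := fun i => by
    induction i with
    | zero => exact Nat.zero_le _
    | succ i ih =>
      have := List.length_pos_iff.mpr (hne _ (hfM _ (hG i)))
      rw [hL, List.length_append]
      omega
  have hmono : ∀ i j, L i <+: L (i + j) := fun i j => by
    induction j with
    | zero => exact List.prefix_rfl
    | succ j ih => exact ih.trans (by rw [← add_assoc, hL]; exact List.prefix_append ..)
  have hmem : ∀ i, ∀ e ∈ L i, ∃ m ∈ M, e ∈ m := fun i => by
    induction i with
    | zero => intro e he; cases he
    | succ i ih =>
      intro e he
      rw [hL, List.mem_append] at he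
      exact he.elim (ih e) fun he => ⟨_, hfM _ (hG i), he⟩
  -- Moves are nonempty, so `L (t + 1)` has an entry at position `t`. The `L i` are prefixes of one
  -- another, so the choice of `t + 1` does not matter.
  let σ : Schedule n := fun t => (L (t + 1))[t]'(hlen (t + 1))
  have hσ : ∀ i t (ht : t < (L i).length), σ t = (L i)[t] := by
    intro i t ht
    rcases le_total i (t + 1) with hi | hi
    · obtain ⟨j, hj⟩ := Nat.exists_eq_add_of_le hi
      have := hmono i j
      rw [← hj] at this
      exact (this.getElem ht).symm
    · obtain ⟨j, rfl⟩ := Nat.exists_eq_add_of_le hi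
      exact (hmono (t + 1) j).getElem (hlen (t + 1))
  have hfirst : ∀ i, firstEvents σ (L i).length = L i := fun i => by
    apply List.ext_getElem
    · simp [firstEvents]
    · intro t h1 h2
      simp [firstEvents, hσ i t h2]
  refine ⟨σ, fun t => hmem (t + 1) _ (List.getElem_mem (hlen (t + 1))), fun s => ⟨_, hlen s, by
    rw [hfirst]; exact hG s⟩, fun s => ⟨_, hlen s, f (L s), hfM _ (hG s), ?_⟩⟩
  rw [hfirst, ← List.length_append, ← hL]
  exact hfirst (s + 1)

/-! ### The effect of single events -/

open Classical in
theorem exec_onObj {c : A.Config} {p : Fin n} {o : A.Obj} {op : T.Op} {k : T.Resp → A.Loc}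
    (h : A.next p (c.loc p) = .onObj o op k) :
    A.exec inp c (.step p) =
      { loc := Function.update c.loc p (k (T.apply (c.obj o) op).2)
        obj := Function.update c.obj o (T.apply (c.obj o) op).1
        reg := c.reg } := by
  simp only [exec, h]

open Classical in
theorem exec_onReg {c : A.Config} {p : Fin n} {r : A.Reg} {op : (register A.RegVal).Op}
    {k : (register A.RegVal).Resp → A.Loc} (h : A.next p (c.loc p) = .onReg r op k) :
    A.exec inp c (.step p) =
      { loc := Function.update c.loc p (k ((register A.RegVal).apply (c.reg r) op).2)
        obj := c.obj
        reg := Function.update c.reg r ((register A.RegVal).apply (c.reg r) op).1 } := by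
  simp only [exec, h]

theorem exec_output {c : A.Config} {p : Fin n} {v : D} (h : A.OutputsIn c p v) :
    A.exec inp c (.step p) = c := by
  unfold OutputsIn at h
  simp only [exec, h]

/-- Inputs enter only through the initial configuration and through crashes. -/
theorem exec_step_congr_input (inp' : Fin n → D) (c : A.Config) (p : Fin n) :
    A.exec inp c (.step p) = A.exec inp' c (.step p) := rfl

theorem run_replicate_congr_input (inp' : Fin n → D) (p : Fin n) (j : ℕ) (c : A.Config) :
    A.run inp c (List.replicate j (.step p)) = A.run inp' c (List.replicate j (.step p)) := by
  induction j generalizing c with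
  | zero => rfl
  | succ j ih => rw [List.replicate_succ, run_cons, run_cons, ih, exec_step_congr_input inp']

theorem exec_step_loc_of_ne {p q : Fin n} (hq : q ≠ p) (c : A.Config) :
    (A.exec inp c (.step p)).loc q = c.loc q := by
  rcases h : A.next p (c.loc p) with v | ⟨o, op, k⟩ | ⟨r, op, k⟩
  · rw [exec_output h]
  · simp [exec_onObj h, hq]
  · simp [exec_onReg h, hq]

theorem run_replicate_loc_of_ne {p q : Fin n} (hq : q ≠ p) (j : ℕ) (c : A.Config) :
    (A.run inp c (List.replicate j (.step p))).loc q = c.loc q := by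
  induction j generalizing c with
  | zero => rfl
  | succ j ih => rw [List.replicate_succ, run_cons, ih, exec_step_loc_of_ne hq]

theorem outputsIn_run {p : Fin n} {v : D} {w : List (Event n)} (hw : ∀ e ∈ w, e ≠ .crash p)
    {c : A.Config} (h : A.OutputsIn c p v) : A.OutputsIn (A.run inp c w) p v := by
  induction w generalizing c with
  | nil => exact h
  | cons e w ih =>
    rw [List.forall_mem_cons] at hw
    refine ih hw.2 ?_
    rcases e with q | q
    · rcases eq_or_ne p q with rfl | hq
      · rwa [exec_output h]
      · rwa [OutputsIn, exec_step_loc_of_ne hq]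
    · rcases eq_or_ne p q with rfl | hq
      · exact absurd rfl hw.1
      · simpa [OutputsIn, exec, hq] using h

theorem firstEvents_le (σ : Schedule n) {s t : ℕ} (h : s ≤ t) :
    ∃ w, firstEvents σ t = firstEvents σ s ++ w ∧ ∀ e ∈ w, ∃ i, s ≤ i ∧ e = σ i := by
  obtain ⟨j, rfl⟩ := Nat.exists_eq_add_of_le h
  refine ⟨(List.range j).map fun i => σ (s + i), ?_, ?_⟩
  · simp [firstEvents, List.range_add]
  · intro e he
    obtain ⟨i, -, rfl⟩ := List.mem_map.mp he
    exact ⟨s + i, Nat.le_add_right .., rfl⟩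

/-- In an infinite execution, a process that never crashes and takes infinitely many steps
cannot be without an output in arbitrarily late configurations. -/
theorem SolvesUnder.false_of_no_outputs {F : Event n → Prop} (hA : A.SolvesUnder F)
    {σ : Schedule n} (hF : ∀ t, F (σ t)) {p : Fin n} (hc : ∀ t, σ t ≠ .crash p)
    (hs : ∀ s, ∃ t, s ≤ t ∧ σ t = .step p)
    (hno : ∀ s, ∃ t, s ≤ t ∧ ∀ v, ¬ A.OutputsIn (A.after inp (firstEvents σ t)) p v) : False := by
  obtain ⟨t, v, -, ho⟩ := (hA inp σ hF).2.2 p 0 (fun t _ => hc t) hs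
  obtain ⟨t', ht, hno⟩ := hno t
  obtain ⟨w, hw, hmem⟩ := firstEvents_le σ ht
  refine hno v ?_
  rw [hw, after_append]
  refine outputsIn_run (fun e he => ?_) (by rwa [Outputs, configAt_eq_after] at ho)
  obtain ⟨i, -, rfl⟩ := hmem e he
  exact hc i


end Executions

/-! ### Configurations that differ in one stack -/

section Near

variable {V D : Type u} {n : ℕ}

/-- The shared objects have the same states in both configurations, except that up to `k`
successive elements of one stack may be different. -/
def Near (A : Algorithm (stack V) n D) (k : ℕ) (c c' : A.Config) : Prop :=
  c.reg = c'.reg ∧ (c.obj = c'.obj ∨ ∃ o, (∀ o', o' ≠ o → c.obj o' = c'.obj o') ∧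
    ∃ t m m' l : List V, c.obj o = t ++ (m ++ l) ∧ c'.obj o = t ++ (m' ++ l) ∧
      m.length = m'.length ∧ m.length ≤ k)

variable {A : Algorithm (stack V) n D} {inp : Fin n → D}

/-- Responses can differ only for a pop with no common element left above the differing block. Such
a pop removes one element of the block on both sides. -/
theorem near_exec_step {k : ℕ} {c c' : A.Config} {p : Fin n} (h : A.Near k c c')
    (hp : c.loc p = c'.loc p) :
    (A.Near k (A.exec inp c (.step p)) (A.exec inp c' (.step p)) ∧
      (A.exec inp c (.step p)).loc p = (A.exec inp c' (.step p)).loc p) ∨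
    ∃ k', k = k' + 1 ∧ A.Near k' (A.exec inp c (.step p)) (A.exec inp c' (.step p)) := by
  classical
  obtain ⟨hr, ho⟩ := h
  rcases hn : A.next p (c.loc p) with v | ⟨o, op, f⟩ | ⟨r, op, f⟩
  · rw [exec_output hn, exec_output (show A.OutputsIn c' p v by rwa [OutputsIn, ← hp])]
    exact .inl ⟨⟨hr, ho⟩, hp⟩
  · rw [exec_onObj hn, exec_onObj (hp ▸ hn)]
    rcases ho with ho | ⟨o₀, hne, t, m, m', l, h1, h2, hlen, hk⟩
    · left
      simp [Near, ho, hr]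
    by_cases hoo : o = o₀
    · subst hoo
      rcases op with x | _
      · left
        refine ⟨⟨hr, .inr ⟨o, fun o' ho' => by simp [ho', hne o' ho'],
          x :: t, m, m', l, ?_, ?_, hlen, hk⟩⟩, ?_⟩
        · simp [stack, h1]
        · simp [stack, h2]
        · simp [stack]
      · rcases t with _ | ⟨x, t⟩
        · rcases m with _ | ⟨a, m⟩ <;> rcases m' with _ | ⟨b, m'⟩
          · left
            have ho : c.obj = c'.obj := by
              funext o'
              by_cases h : o' = o
              · subst h; exact h1.trans h2.symm
              · exact hne o' h
            simp [Near, ho, hr]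
          · simp at hlen
          · simp at hlen
          · right
            obtain ⟨k', rfl⟩ : ∃ k', k = k' + 1 := ⟨k - 1, by simp at hk; omega⟩
            refine ⟨k', rfl, hr, .inr ⟨o, fun o' ho' => by simp [ho', hne o' ho'],
              [], m, m', l, ?_, ?_, by simpa using hlen, by simpa using hk⟩⟩
            · simp [stack, h1]
            · simp [stack, h2]
        · left
          refine ⟨⟨hr, .inr ⟨o, fun o' ho' => by simp [ho', hne o' ho'],
            t, m, m', l, ?_, ?_, hlen, hk⟩⟩, ?_⟩
          · simp [stack, h1]
          · simp [stack, h2]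
          · simp [stack, h1, h2]
    · left
      refine ⟨⟨hr, .inr ⟨o₀, fun o' ho' => ?_, t, m, m', l, ?_, ?_, hlen, hk⟩⟩, ?_⟩
      · by_cases h : o' = o
        · subst h; simp [hne _ hoo]
        · simp [h, hne _ ho']
      · simpa [Ne.symm hoo] using h1
      · simpa [Ne.symm hoo] using h2
      · simp [hne _ hoo]
  · rw [exec_onReg hn, exec_onReg (hp ▸ hn)]
    left
    simpa [Near, hr] using ho

/-- The two runs of `p` proceed in lockstep until `p` outputs or pops from the differing block. In
the latter case nothing is known about the local states of `p`, so the next solo run needs another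
process or a crash. -/
theorem near_run_solo {k j : ℕ} {c c' : A.Config} {p : Fin n} {v : D} (h : A.Near k c c')
    (hp : c.loc p = c'.loc p)
    (hv : A.OutputsIn (A.run inp c (List.replicate j (.step p))) p v) :
    ∃ i, (A.OutputsIn (A.run inp c (List.replicate i (.step p))) p v ∧
        A.OutputsIn (A.run inp c' (List.replicate i (.step p))) p v) ∨
      ∃ k', k = k' + 1 ∧ A.Near k' (A.run inp c (List.replicate i (.step p)))
        (A.run inp c' (List.replicate i (.step p))) := by
  induction j generalizing c c' with
  | zero => exact ⟨0, .inl ⟨hv, by simpa [OutputsIn, hp] using hv⟩⟩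
  | succ j ih =>
    rcases near_exec_step (inp := inp) h hp with ⟨h', hp'⟩ | ⟨k', hk, h'⟩
    · obtain ⟨i, hi⟩ := ih h' hp' hv
      exact ⟨i + 1, hi⟩
    · exact ⟨1, .inr ⟨k', hk, h'⟩⟩

theorem near_of_eq {k : ℕ} {c c' : A.Config} (hr : c.reg = c'.reg) (ho : c.obj = c'.obj) :
    A.Near k c c' := ⟨hr, .inl ho⟩

/-- Two pending steps of different processes: one overwrites or ignores the other,
or the order of the steps is visible only in the local states and in as many elements of a single
stack as there are processes among the two that do not notice the order. -/
theorem step_conflict {c : A.Config} {p q : Fin n} (hpq : p ≠ q)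
    (hp : ∀ v, ¬ A.OutputsIn c p v) (hq : ∀ v, ¬ A.OutputsIn c q v) :
    let cp := A.exec inp c (.step p)
    let cq := A.exec inp c (.step q)
    let cpq := A.exec inp cp (.step q)
    let cqp := A.exec inp cq (.step p)
    (A.Near 0 cpq cq ∧ cpq.loc q = cq.loc q) ∨ (A.Near 0 cqp cp ∧ cqp.loc p = cp.loc p) ∨
      ∃ S : List (Fin n), S.Nodup ∧ (∀ x ∈ S, x = p ∨ x = q) ∧
        (∀ x ∈ S, cpq.loc x = cqp.loc x) ∧ A.Near S.length cpq cqp := by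
  classical
  intro cp cq cpq cqp
  have hq' : cp.loc q = c.loc q := exec_step_loc_of_ne hpq.symm c
  have hp' : cq.loc p = c.loc p := exec_step_loc_of_ne hpq c
  have hqp := hpq.symm
  rcases hnp : A.next p (c.loc p) with v | ⟨o, op, f⟩ | ⟨r, op, f⟩
  · exact absurd hnp (hp v)
  · have ecp : cp = _ := exec_onObj hnp
    have ecqp : cqp = _ := exec_onObj (c := cq) (hp'.symm ▸ hnp)
    rcases hnq : A.next q (c.loc q) with v | ⟨o', op', f'⟩ | ⟨r', op', f'⟩
    · exact absurd hnq (hq v)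
    · have ecq : cq = _ := exec_onObj hnq
      have ecpq : cpq = _ := exec_onObj (c := cp) (hq'.symm ▸ hnq)
      by_cases hoo : o = o'
      · subst hoo
        rcases op with x | _ <;> rcases op' with y | _
        -- Both pushes are only acknowledged, so neither process notices the order, which shows in
        -- the two top elements.
        · refine .inr <| .inr ⟨[p, q], by simp [hpq], by simp, ?_, ?_, .inr ⟨o, ?_,
            [], [y, x], [x, y], c.obj o, ?_, ?_, rfl, le_rfl⟩⟩
          · simp [ecpq, ecqp, ecp, ecq, stack, hpq, hqp]
          · simp [ecpq, ecqp, ecp, ecq]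
          · intro o' ho'; simp [ecpq, ecqp, ecp, ecq, ho']
          · simp [ecpq, ecp, stack]
          · simp [ecqp, ecq, stack]
        -- On an empty stack the pop of `q` has no effect that `p` could see. Otherwise `q` removes
        -- `x` or `a` depending on the order, and only `p` is unaware of it.
        · rcases hs : (c.obj o : List V) with _ | ⟨a, l⟩
          · refine .inr <| .inl ⟨near_of_eq ?_ ?_, ?_⟩
            · simp [ecqp, ecp, ecq]
            · simp [ecqp, ecp, ecq, stack, hs]
            · simp [ecqp, ecp, ecq, stack, hs]
          · refine .inr <| .inr ⟨[p], by simp, by simp, ?_, ?_, .inr ⟨o, ?_,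
              [], [a], [x], l, ?_, ?_, rfl, le_rfl⟩⟩
            · simp [ecpq, ecqp, ecp, ecq, stack, hpq]
            · simp [ecpq, ecqp, ecp, ecq]
            · intro o' ho'; simp [ecpq, ecqp, ecp, ecq, ho']
            · simp [ecpq, ecp, stack, hs]
            · simp [ecqp, ecq, stack, hs]
        · rcases hs : (c.obj o : List V) with _ | ⟨a, l⟩
          · refine .inl ⟨near_of_eq ?_ ?_, ?_⟩
            · simp [ecpq, ecp, ecq]
            · simp [ecpq, ecp, ecq, stack, hs]
            · simp [ecpq, ecp, ecq, stack, hs]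
          · refine .inr <| .inr ⟨[q], by simp, by simp, ?_, ?_, .inr ⟨o, ?_,
              [], [y], [a], l, ?_, ?_, rfl, le_rfl⟩⟩
            · simp [ecpq, ecqp, ecp, ecq, stack, hqp]
            · simp [ecpq, ecqp, ecp, ecq]
            · intro o' ho'; simp [ecpq, ecqp, ecp, ecq, ho']
            · simp [ecpq, ecp, stack, hs]
            · simp [ecqp, ecq, stack, hs]
        -- Two pops may exchange their responses, but both orders leave the same stack.
        · refine .inr <| .inr ⟨[], by simp, by simp, by simp, near_of_eq ?_ ?_⟩
          · simp [ecpq, ecqp, ecp, ecq]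
          · simp [ecpq, ecqp, ecp, ecq]
      · refine .inr <| .inr ⟨[], by simp, by simp, by simp, near_of_eq ?_ ?_⟩
        · simp [ecpq, ecqp, ecp, ecq]
        · simp [ecpq, ecqp, ecp, ecq, hoo, Ne.symm hoo, Function.update_comm]
    · have ecq : cq = _ := exec_onReg hnq
      have ecpq : cpq = _ := exec_onReg (c := cp) (hq'.symm ▸ hnq)
      refine .inr <| .inr ⟨[], by simp, by simp, by simp, near_of_eq ?_ ?_⟩
      · simp [ecpq, ecqp, ecp, ecq]
      · simp [ecpq, ecqp, ecp, ecq]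
  · have ecp : cp = _ := exec_onReg hnp
    have ecqp : cqp = _ := exec_onReg (c := cq) (hp'.symm ▸ hnp)
    rcases hnq : A.next q (c.loc q) with v | ⟨o', op', f'⟩ | ⟨r', op', f'⟩
    · exact absurd hnq (hq v)
    · have ecq : cq = _ := exec_onObj hnq
      have ecpq : cpq = _ := exec_onObj (c := cp) (hq'.symm ▸ hnq)
      refine .inr <| .inr ⟨[], by simp, by simp, by simp, near_of_eq ?_ ?_⟩
      · simp [ecpq, ecqp, ecp, ecq]
      · simp [ecpq, ecqp, ecp, ecq]
    · have ecq : cq = _ := exec_onReg hnq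
      have ecpq : cpq = _ := exec_onReg (c := cp) (hq'.symm ▸ hnq)
      rcases op' with _ | y
      · refine .inr <| .inl ⟨near_of_eq ?_ ?_, ?_⟩
        · simp [ecqp, ecp, ecq, register]
        · simp [ecqp, ecp, ecq]
        · simp [ecqp, ecp, ecq, register]
      · by_cases hrr : r = r'
        · subst hrr
          refine .inl ⟨near_of_eq ?_ ?_, ?_⟩
          · simp [ecpq, ecp, ecq, register]
          · simp [ecpq, ecp, ecq]
          · simp [ecpq, ecp, ecq, register]
        · refine .inr <| .inr ⟨[], by simp, by simp, by simp, near_of_eq ?_ ?_⟩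
          · have hr : cq.reg r = c.reg r := by rw [ecq]; exact Function.update_of_ne hrr ..
            have hr' : cp.reg r' = c.reg r' := by
              rw [ecp]; exact Function.update_of_ne (Ne.symm hrr) ..
            rw [ecpq, ecqp, hr, hr', ecp, ecq]
            exact Function.update_comm hrr ..
          · simp [ecpq, ecqp, ecp, ecq]


end Near

/-! ### Valency -/

section Valency

variable {T : ObjType.{u}} {n : ℕ} {D : Type u}

/-- Two different values can be output after `h` by continuing with event sequences in `Adm`. -/
def Bivalent (A : Algorithm T n D) (inp : Fin n → D) (Adm : List (Event n) → Prop)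
    (h : List (Event n)) : Prop :=
  ∃ w w' p p' v v', Adm w ∧ Adm w' ∧ A.OutputsIn (A.after inp (h ++ w)) p v ∧
    A.OutputsIn (A.after inp (h ++ w')) p' v' ∧ v ≠ v'

variable {A : Algorithm T n D} {inp : Fin n → D} {Adm : List (Event n) → Prop}
  {F : Event n → Prop} {h : List (Event n)}

theorem eq_of_not_bivalent (hb : ¬ A.Bivalent inp Adm h) {w w' : List (Event n)} {p p' : Fin n}
    {v v' : D} (hw : Adm w) (hw' : Adm w') (ho : A.OutputsIn (A.after inp (h ++ w)) p v)
    (ho' : A.OutputsIn (A.after inp (h ++ w')) p' v') : v = v' :=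
  by_contra fun hne => hb ⟨w, w', p, p', v, v', hw, hw', ho, ho', hne⟩

/-- By agreement, one output fixes all later ones. Thus no process has an output after a bivalent
execution, and staying bivalent forever contradicts wait-freedom. -/
theorem SolvesUnder.not_bivalent (hA : A.SolvesUnder F) (hs : ∀ p, F (.step p))
    (hF : ∀ w, Adm w → ∀ e ∈ h ++ w, F e) {p : Fin n} {v : D}
    (ho : A.OutputsIn (A.after inp h) p v) : ¬ A.Bivalent inp Adm h := by
  rintro ⟨w, w', q, q', u, u', hw, hw', h1, h2, hne⟩
  exact hne ((hA.agree hs (hF w hw) ho h1).symm.trans (hA.agree hs (hF w' hw') ho h2))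

end Valency

/-! ### Impossibility proofs at critical executions -/

section Impossibility

variable {V D : Type u} {n : ℕ} {A : Algorithm (stack V) n D} {inp : Fin n → D}

/-- A process that runs alone from the beginning outputs its own input. -/
theorem SolvesUnder.solo_initial {F : Event n → Prop} (hA : A.SolvesUnder F)
    (hs : ∀ p, F (.step p)) (p : Fin n) :
    ∃ j, A.OutputsIn (A.after inp (List.replicate j (.step p))) p (inp p) := by
  -- If all inputs equal `inp p`, validity determines the output, and a solo run of `p` does not
  -- depend on the other inputs.
  obtain ⟨j, v, ho⟩ := hA.solo (inp := fun _ => inp p) hs (h := []) (by simp) p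
  rw [List.nil_append] at ho
  obtain ⟨_, rfl⟩ := hA.valid hs (by simp only [List.mem_replicate]; rintro _ ⟨-, rfl⟩; exact hs p) ho
  have h0 : A.Near 0 (A.initial fun _ => inp p) (A.initial inp) := near_of_eq rfl rfl
  obtain ⟨i, ⟨-, hi⟩ | ⟨_, h, -⟩⟩ := near_run_solo h0 rfl ho
  · exact ⟨i, by rwa [run_replicate_congr_input inp] at hi⟩
  · cases h

theorem SolvesUnder.bivalent_nil {F : Event n → Prop} (hA : A.SolvesUnder F)
    (hs : ∀ p, F (.step p)) {Adm : List (Event n) → Prop} {p q : Fin n}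
    (hp : ∀ j, Adm (List.replicate j (.step p))) (hq : ∀ j, Adm (List.replicate j (.step q)))
    (hne : inp p ≠ inp q) : A.Bivalent inp Adm [] := by
  obtain ⟨i, hi⟩ := hA.solo_initial (inp := inp) hs p
  obtain ⟨j, hj⟩ := hA.solo_initial (inp := inp) hs q
  exact ⟨_, _, p, q, _, _, hp i, hq j, hi, hj, hne⟩

/-- If a process has the same local state in configurations with equal shared objects, then
letting it run alone yields a common output. -/
theorem SolvesUnder.common_output {F : Event n → Prop} (hA : A.SolvesUnder F)
    (hs : ∀ p, F (.step p)) {h h' : List (Event n)} (hF : ∀ e ∈ h, F e) {p : Fin n}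
    (hN : A.Near 0 (A.after inp h) (A.after inp h'))
    (hp : (A.after inp h).loc p = (A.after inp h').loc p) :
    ∃ i v, A.OutputsIn (A.after inp (h ++ List.replicate i (.step p))) p v ∧
      A.OutputsIn (A.after inp (h' ++ List.replicate i (.step p))) p v := by
  obtain ⟨j, v, ho⟩ := hA.solo (inp := inp) hs hF p
  simp only [after_append] at ho ⊢
  obtain ⟨i, hi | ⟨_, h, -⟩⟩ := near_run_solo hN hp ho
  · exact ⟨i, v, hi⟩
  · cases h

/-! ### Recoverable consensus -/

section Recoverable

variable {p q : Fin n}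

/-- An event of `p` or `q` that is not a crash of `p`. -/
def OnlySecondCrashes (p q : Fin n) (e : Event n) : Prop :=
  e = .step p ∨ e = .step q ∨ e = .crash q

/-- Process `p` never crashes, and process `q` does not crash before the first step of `p`. -/
def CrashAfterStep (p q : Fin n) : List (Event n) → Prop
  | [] => True
  | e :: w => (e = .step q ∧ CrashAfterStep p q w) ∨
      (e = .step p ∧ ∀ e ∈ w, OnlySecondCrashes p q e)

theorem crashAfterStep_replicate_second (j : ℕ) :
    CrashAfterStep p q (List.replicate j (.step q)) := by
  induction j with
  | zero => trivial
  | succ j ih => exact .inl ⟨rfl, ih⟩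

theorem crashAfterStep_replicate_first (j : ℕ) :
    CrashAfterStep p q (List.replicate j (.step p)) := by
  cases j with
  | zero => trivial
  | succ j => exact .inr ⟨rfl, fun e he => .inl (List.eq_of_mem_replicate he)⟩

/-- Otherwise every bivalent execution has a longer bivalent extension: `q` runs alone up to the
step that would destroy bivalence, then `p` takes a step, followed by events of `q`. Repeating this,
`p` takes infinitely many steps, never crashes and never outputs. The last clause ranges over all
`w` because admissibility starts afresh after `w`, so nonbivalence after the step of `p` alone would
not control crashes of `q` that come before the next step of `p`. -/
theorem SolvesUnder.exists_critical_of_crashes (hA : A.SolvesUnder fun _ => True) (hpq : p ≠ q)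
    (h0 : A.Bivalent inp (CrashAfterStep p q) []) :
    ∃ h, A.Bivalent inp (CrashAfterStep p q) h ∧
      ¬ A.Bivalent inp (CrashAfterStep p q) (h ++ [.step q]) ∧
      ∀ w, (∀ e ∈ w, e = .step q ∨ e = .crash q) →
        ¬ A.Bivalent inp (CrashAfterStep p q) (h ++ .step p :: w) := by
  classical
  by_contra! hcon
  obtain ⟨σ, h1, h2, h3⟩ := exists_schedule_of_extendable
    (Good := A.Bivalent inp (CrashAfterStep p q))
    (M := {m | Event.step p ∈ m ∧ Event.crash p ∉ m}) h0
    (fun m hm => List.ne_nil_of_mem hm.1) (by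
      intro h hb
      have hex : ∃ k, ¬ A.Bivalent inp (CrashAfterStep p q) (h ++ List.replicate k (.step q)) := by
        obtain ⟨j, v, ho⟩ := hA.solo (inp := inp) (fun _ => trivial) (h := h) (by simp) q
        exact ⟨j, hA.not_bivalent (fun _ => trivial) (by simp) ho⟩
      have hk := Nat.find_spec hex
      have hmin := fun m => Nat.find_min (m := m) hex
      revert hk hmin
      generalize Nat.find hex = k
      intro hk hmin
      rcases k with _ | k
      · simp [hb] at hk
      rw [List.replicate_succ', ← List.append_assoc] at hk
      obtain ⟨w, hw, hbw⟩ := hcon _ (not_not.mp (hmin k (Nat.lt_succ_self k))) hk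
      refine ⟨List.replicate k (.step q) ++ .step p :: w, ⟨by simp, fun hc => ?_⟩, by
        rwa [← List.append_assoc]⟩
      rw [List.mem_append, List.mem_cons] at hc
      rcases hc with hc | hc | hc
      · cases List.eq_of_mem_replicate hc
      · cases hc
      · rcases hw _ hc with hc | hc
        · cases hc
        · exact hpq (by cases hc; rfl))
  refine hA.false_of_no_outputs (inp := inp) (σ := σ) (p := p) (fun _ => trivial) ?_ ?_ ?_
  · intro t ht
    obtain ⟨m, hm, hmem⟩ := h1 t
    exact hm.2 (ht ▸ hmem)
  · intro s
    obtain ⟨t, hst, m, hm, hmt⟩ := h3 s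
    obtain ⟨w, hw, hmem⟩ := firstEvents_le σ (Nat.le_add_right t m.length)
    rw [hw, List.append_cancel_left_eq] at hmt
    obtain ⟨i, hi, he⟩ := hmem _ (hmt ▸ hm.1)
    exact ⟨i, hst.trans hi, he.symm⟩
  · intro s
    obtain ⟨t, hst, ht⟩ := h2 s
    exact ⟨t, hst, fun v ho => hA.not_bivalent (fun _ => trivial) (by simp) ho ht⟩

/-- A process that can crash repeatedly forgets, one by one, the stack elements that distinguish
two configurations. -/
theorem SolvesUnder.eq_of_near_of_crashes (hA : A.SolvesUnder fun _ => True) {k : ℕ}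
    {h h' : List (Event n)} {v v' : D} (hN : A.Near k (A.after inp h) (A.after inp h'))
    (hv : ∀ w, (∀ e ∈ w, OnlySecondCrashes p q e) → ∀ r u,
      A.OutputsIn (A.after inp (h ++ w)) r u → u = v)
    (hv' : ∀ w, (∀ e ∈ w, OnlySecondCrashes p q e) → ∀ r u,
      A.OutputsIn (A.after inp (h' ++ w)) r u → u = v') : v = v' := by
  induction k using Nat.strong_induction_on generalizing h h' with
  | _ k ih =>
    obtain ⟨j, u, ho⟩ := hA.solo (inp := inp) (fun _ => trivial) (h := h ++ [.crash q]) (by simp) q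
    have hmem : ∀ i, ∀ e ∈ [Event.crash q] ++ List.replicate i (.step q),
        OnlySecondCrashes p q e := by
      intro i e he
      rcases List.mem_append.mp he with he | he
      · exact .inr (.inr (List.mem_singleton.mp he))
      · exact .inr (.inl (List.eq_of_mem_replicate he))
    rw [after_append] at ho
    have hN' : A.Near k (A.after inp (h ++ [.crash q])) (A.after inp (h' ++ [.crash q])) := by
      rw [after_append, after_append]; exact hN
    have hloc : (A.after inp (h ++ [.crash q])).loc q = (A.after inp (h' ++ [.crash q])).loc q := by
      simp [after_append, exec]
    obtain ⟨i, ⟨h1, h2⟩ | ⟨k', rfl, h1⟩⟩ := near_run_solo hN' hloc ho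
    · rw [← after_append, List.append_assoc] at h1 h2
      exact (hv _ (hmem i) _ _ h1).symm.trans (hv' _ (hmem i) _ _ h2)
    · rw [← after_append, ← after_append, List.append_assoc, List.append_assoc] at h1
      refine ih k' (Nat.lt_succ_self k') h1 (fun w hw r u ho => ?_) (fun w hw r u ho => ?_)
      · rw [List.append_assoc] at ho
        exact hv _ (fun e he => (List.mem_append.mp he).elim (hmem i e) (hw e)) r u ho
      · rw [List.append_assoc] at ho
        exact hv' _ (fun e he => (List.mem_append.mp he).elim (hmem i e) (hw e)) r u ho

/-- After a step of `p` at a critical execution, crashes of `q` no longer matter. -/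
theorem SolvesUnder.exists_value_of_crashes (hA : A.SolvesUnder fun _ => True) (hpq : p ≠ q)
    {h : List (Event n)}
    (hb : ∀ w, (∀ e ∈ w, e = .step q ∨ e = .crash q) →
      ¬ A.Bivalent inp (CrashAfterStep p q) (h ++ w)) :
    ∃ v, ∀ w, (∀ e ∈ w, OnlySecondCrashes p q e) → ∀ r u,
      A.OutputsIn (A.after inp (h ++ w)) r u → u = v := by
  have hT : ∀ r : Fin n, (fun _ : Event n => True) (.step r) := fun _ => trivial
  obtain ⟨j, v, hv⟩ := hA.solo (inp := inp) hT (h := h) (by simp) p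
  -- Induction on the events of `q`: a step of `q` belongs to an admissible continuation, and a
  -- crash of `q` is invisible to `p`, whose solo run yields a common output.
  have key : ∀ w, (∀ e ∈ w, e = .step q ∨ e = .crash q) → ∀ x, CrashAfterStep p q x → ∀ r u,
      A.OutputsIn (A.after inp (h ++ w ++ x)) r u → u = v := by
    intro w
    induction w using List.reverseRecOn with
    | nil =>
      intro hw x hx r u ho
      refine eq_of_not_bivalent (hb [] hw) hx (crashAfterStep_replicate_first j) (p' := p) ho ?_
      rwa [List.append_nil]
    | append_singleton w e ih =>
      intro hw x hx r u ho
      have hw' := fun e he => hw e (List.mem_append_left _ he)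
      rcases hw e (by simp) with rfl | rfl
      · refine ih hw' (.step q :: x) (.inl ⟨rfl, hx⟩) r u ?_
        simpa using ho
      · have hN : A.Near 0 (A.after inp (h ++ w)) (A.after inp (h ++ (w ++ [.crash q]))) := by
          rw [← List.append_assoc, after_append _ [_]]
          exact near_of_eq rfl rfl
        obtain ⟨i, v', h1, h2⟩ := hA.common_output hT (by simp) hN (p := p) (by
          rw [← List.append_assoc, after_append _ [_]]
          simp [exec, hpq])
        rw [eq_of_not_bivalent (hb _ hw) hx (crashAfterStep_replicate_first i) ho h2]
        exact ih hw' _ (crashAfterStep_replicate_first i) _ _ h1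
  -- Cut before the first step of `p`.
  have split : ∀ w, (∀ e ∈ w, OnlySecondCrashes p q e) → ∃ y x, w = y ++ x ∧
      (∀ e ∈ y, e = .step q ∨ e = .crash q) ∧ CrashAfterStep p q x := by
    intro w
    induction w with
    | nil => exact fun _ => ⟨[], [], rfl, by simp, trivial⟩
    | cons e w ih =>
      intro hw
      rw [List.forall_mem_cons] at hw
      rcases hw.1 with he | he
      · exact ⟨[], e :: w, rfl, by simp, .inr ⟨he, hw.2⟩⟩
      · obtain ⟨y, x, rfl, hy, hx⟩ := ih hw.2
        exact ⟨e :: y, x, rfl, List.forall_mem_cons.mpr ⟨he, hy⟩, hx⟩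
  refine ⟨v, fun w hw r u ho => ?_⟩
  obtain ⟨y, x, rfl, hy, hx⟩ := split w hw
  exact key y hy x hx r u (by rwa [List.append_assoc])

theorem not_solvesRC_of_ne (hpq : p ≠ q) [Nontrivial D] : ¬ A.SolvesRC := by
  intro hRC
  have hA : A.SolvesUnder fun _ => True := fun inp σ _ => hRC inp σ
  have hT : ∀ r : Fin n, (fun _ : Event n => True) (.step r) := fun _ => trivial
  obtain ⟨a, b, hab⟩ := exists_pair_ne D
  let inp : Fin n → D := fun r => if r = p then a else b
  obtain ⟨h, hb, hbq, hbp⟩ := hA.exists_critical_of_crashes (inp := inp) hpq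
    (hA.bivalent_nil hT (p := p) (q := q) crashAfterStep_replicate_first
      crashAfterStep_replicate_second (by simpa [inp, hpq.symm] using hab))
  have hno : ∀ r v, ¬ A.OutputsIn (A.after inp h) r v := fun r v ho =>
    hA.not_bivalent hT (by simp) ho hb
  obtain ⟨v₀, hv₀⟩ := hA.exists_value_of_crashes (inp := inp) (h := h ++ [.step p]) hpq
    (fun w hw => by rw [List.append_assoc]; exact hbp w hw)
  obtain ⟨j, v₁, hv₁⟩ := hA.solo (inp := inp) hT (h := h ++ [.step q]) (by simp) q
  have hv₁ : ∀ w, CrashAfterStep p q w → ∀ r u,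
      A.OutputsIn (A.after inp (h ++ [.step q] ++ w)) r u → u = v₁ := fun w hw r u ho =>
    eq_of_not_bivalent hbq hw (crashAfterStep_replicate_second j) ho hv₁
  have hfree : ∀ w, (∀ e ∈ w, OnlySecondCrashes p q e) → CrashAfterStep p q (.step p :: w) :=
    fun w hw => .inr ⟨rfl, hw⟩
  -- A nonempty admissible continuation of `h` starts with a step of `p` or `q`, so equal values
  -- would contradict bivalence.
  have hne : v₀ ≠ v₁ := by
    rintro rfl
    have hval : ∀ w, CrashAfterStep p q w → ∀ r u, A.OutputsIn (A.after inp (h ++ w)) r u →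
        u = v₀ := by
      rintro (_ | ⟨e, w⟩) hw r u ho
      · exact absurd (by simpa using ho) (hno r u)
      · rcases hw with ⟨rfl, hw⟩ | ⟨rfl, hw⟩
        · exact hv₁ w hw r u (by simpa using ho)
        · exact hv₀ w hw r u (by simpa using ho)
    obtain ⟨w, w', r, r', u, u', hw, hw', ho, ho', hu⟩ := hb
    exact hu ((hval w hw r u ho).trans (hval w' hw' r' u' ho').symm)
  have hmem : ∀ r, r = p ∨ r = q → ∀ j, ∀ e ∈ List.replicate j (Event.step r),
      OnlySecondCrashes p q e := by
    rintro r (rfl | rfl) j e he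
    · exact .inl (List.eq_of_mem_replicate he)
    · exact .inr (.inl (List.eq_of_mem_replicate he))
  have hone : ∀ (h : List (Event n)) e, A.exec inp (A.after inp h) e = A.after inp (h ++ [e]) :=
    fun h e => (after_append h [e]).symm
  have hpq' := step_conflict (inp := inp) hpq (hno p) (hno q)
  simp only [hone] at hpq'
  rcases hpq' with ⟨hN, hl⟩ | ⟨hN, hl⟩ | ⟨S, -, -, -, hN⟩
  · obtain ⟨i, v, h1, h2⟩ := hA.common_output hT (by simp) hN hl
    refine hne ((hv₀ (.step q :: List.replicate i (.step q)) ?_ _ _ (by simpa using h1)).symm.trans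
      (hv₁ _ (crashAfterStep_replicate_second i) _ _ h2))
    exact hmem q (.inr rfl) (i + 1)
  · obtain ⟨i, v, h1, h2⟩ := hA.common_output hT (by simp) hN hl
    exact hne ((hv₀ _ (hmem p (.inl rfl) i) _ _ h2).symm.trans
      (hv₁ _ (crashAfterStep_replicate_first (i + 1)) _ _ (by
        simpa [List.replicate_succ] using h1)))
  -- In both orders `p` has already taken its step, so `q` may now crash at will.
  · refine hne (hA.eq_of_near_of_crashes (p := p) (q := q) hN (fun w hw r u ho => ?_)
      (fun w hw r u ho => ?_))
    · exact hv₀ (.step q :: w) (List.forall_mem_cons.mpr ⟨.inr (.inl rfl), hw⟩) r u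
        (by simpa using ho)
    · exact hv₁ _ (hfree w hw) r u (by simpa using ho)

end Recoverable

/-! ### Consensus without crashes -/

/-- An event that is not a crash. -/
def NoCrash (e : Event n) : Prop := ∀ p, e ≠ .crash p

theorem noCrash_step (p : Fin n) : NoCrash (.step p) := by simp [NoCrash]

theorem NoCrash.exists_step {e : Event n} (h : NoCrash e) : ∃ p, e = .step p := by
  rcases e with p | p
  · exact ⟨p, rfl⟩
  · exact absurd rfl (h p)

theorem noCrash_replicate (p : Fin n) (j : ℕ) : ∀ e ∈ List.replicate j (Event.step p), NoCrash e :=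
  fun _ he => List.eq_of_mem_replicate he ▸ noCrash_step p

theorem noCrash_append {w w' : List (Event n)} (hw : ∀ e ∈ w, NoCrash e)
    (hw' : ∀ e ∈ w', NoCrash e) : ∀ e ∈ w ++ w', NoCrash e :=
  List.forall_mem_append.mpr ⟨hw, hw'⟩

/-- Otherwise bivalence can be preserved step by step forever. As there are finitely many processes,
one of them takes infinitely many steps and never outputs. -/
theorem SolvesUnder.exists_critical (hA : A.SolvesUnder NoCrash)
    (h0 : A.Bivalent inp (fun w => ∀ e ∈ w, NoCrash e) []) :
    ∃ h, (∀ e ∈ h, NoCrash e) ∧ A.Bivalent inp (fun w => ∀ e ∈ w, NoCrash e) h ∧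
      ∀ p, ¬ A.Bivalent inp (fun w => ∀ e ∈ w, NoCrash e) (h ++ [.step p]) := by
  by_contra! hcon
  obtain ⟨σ, h1, h2, -⟩ := exists_schedule_of_extendable
    (Good := fun h => (∀ e ∈ h, NoCrash e) ∧ A.Bivalent inp (fun w => ∀ e ∈ w, NoCrash e) h)
    (M := {m | ∃ p, m = [Event.step p]}) ⟨by simp, h0⟩
    (by rintro _ ⟨p, rfl⟩; simp)
    (fun h hh => by
      obtain ⟨p, hp⟩ := hcon h hh.1 hh.2
      exact ⟨_, ⟨p, rfl⟩, noCrash_append hh.1 (noCrash_replicate p 1), hp⟩)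
  have hσ : ∀ t, ∃ p, σ t = .step p := fun t => by
    obtain ⟨_, ⟨p, rfl⟩, ht⟩ := h1 t
    exact ⟨p, List.mem_singleton.mp ht⟩
  have hF : ∀ t, NoCrash (σ t) := fun t => by
    obtain ⟨p, hp⟩ := hσ t
    exact hp ▸ noCrash_step p
  obtain ⟨p, hp⟩ : ∃ p, ∀ s, ∃ t, s ≤ t ∧ σ t = .step p := by
    by_contra! hfin
    choose s hs using hfin
    -- If each process `p` stopped before time `s p`, nobody could take the step at the maximum of
    -- these times.
    obtain ⟨p, hp⟩ := hσ (Finset.univ.sup s)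
    exact hs p _ (Finset.le_sup (Finset.mem_univ p)) hp
  refine hA.false_of_no_outputs (inp := inp) hF (fun t => hF t p) hp fun s => ?_
  obtain ⟨t, hst, ht, hb⟩ := h2 s
  exact ⟨t, hst, fun v ho => hA.not_bivalent noCrash_step (fun w hw => noCrash_append ht hw) ho hb⟩

/-- Processes that run one after another consume the stack elements that distinguish two
configurations. -/
theorem SolvesUnder.eq_of_near (hA : A.SolvesUnder NoCrash) {S : List (Fin n)} (hS : S.Nodup)
    {k : ℕ} (hk : k < S.length) {h h' : List (Event n)} (hh : ∀ e ∈ h, NoCrash e) {v v' : D}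
    (hN : A.Near k (A.after inp h) (A.after inp h'))
    (hloc : ∀ p ∈ S, (A.after inp h).loc p = (A.after inp h').loc p)
    (hv : ∀ w, (∀ e ∈ w, NoCrash e) → ∀ r u, A.OutputsIn (A.after inp (h ++ w)) r u → u = v)
    (hv' : ∀ w, (∀ e ∈ w, NoCrash e) → ∀ r u, A.OutputsIn (A.after inp (h' ++ w)) r u → u = v') :
    v = v' := by
  induction S generalizing k h h' with
  | nil => cases hk
  | cons p S ih =>
    obtain ⟨j, u, ho⟩ := hA.solo (inp := inp) noCrash_step hh p
    rw [after_append] at ho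
    rw [List.nodup_cons] at hS
    obtain ⟨i, ⟨h1, h2⟩ | ⟨k', rfl, h1⟩⟩ := near_run_solo hN (hloc p (by simp)) ho
    · rw [← after_append] at h1 h2
      exact (hv _ (noCrash_replicate p i) _ _ h1).symm.trans (hv' _ (noCrash_replicate p i) _ _ h2)
    · rw [← after_append, ← after_append] at h1
      refine ih hS.2 (Nat.lt_of_succ_lt_succ hk) (noCrash_append hh (noCrash_replicate p i)) h1
        (fun r hr => ?_) (fun w hw r u ho => ?_) (fun w hw r u ho => ?_)
      · have hrp : r ≠ p := fun h => hS.1 (h ▸ hr)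
        rw [after_append, after_append, run_replicate_loc_of_ne hrp, run_replicate_loc_of_ne hrp]
        exact hloc r (List.mem_cons_of_mem _ hr)
      · rw [List.append_assoc] at ho
        exact hv _ (noCrash_append (noCrash_replicate p i) hw) r u ho
      · rw [List.append_assoc] at ho
        exact hv' _ (noCrash_append (noCrash_replicate p i) hw) r u ho

theorem not_solvesConsensus [Nontrivial D] (hn : 3 ≤ n) : ¬ A.SolvesConsensus := by
  intro hC
  have hA : A.SolvesUnder NoCrash := fun inp σ hσ => hC inp σ hσ
  obtain ⟨a, b, hab⟩ := exists_pair_ne D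
  let p₀ : Fin n := ⟨0, by omega⟩
  let p₁ : Fin n := ⟨1, by omega⟩
  have hp : p₁ ≠ p₀ := by simp [p₀, p₁]
  let inp : Fin n → D := fun r => if r = p₀ then a else b
  obtain ⟨h, hh, hb, hbs⟩ := hA.exists_critical (inp := inp)
    (hA.bivalent_nil noCrash_step (noCrash_replicate p₀) (noCrash_replicate p₁)
      (by simpa [inp, hp] using hab))
  have hno : ∀ r v, ¬ A.OutputsIn (A.after inp h) r v := fun r v ho =>
    hA.not_bivalent noCrash_step (fun w hw => noCrash_append hh hw) ho hb
  have hhs : ∀ p, ∀ e ∈ h ++ [Event.step p], NoCrash e := fun p =>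
    noCrash_append hh (noCrash_replicate p 1)
  have hval : ∀ p, ∃ v, ∀ w, (∀ e ∈ w, NoCrash e) → ∀ r u,
      A.OutputsIn (A.after inp (h ++ [.step p] ++ w)) r u → u = v := fun p => by
    obtain ⟨j, v, hv⟩ := hA.solo (inp := inp) noCrash_step (hhs p) p
    exact ⟨v, fun w hw r u ho => eq_of_not_bivalent (hbs p) hw (noCrash_replicate p j) ho hv⟩
  choose val hval using hval
  obtain ⟨p, q, hne⟩ : ∃ p q, val p ≠ val q := by
    by_contra! heq
    have hall : ∀ w, (∀ e ∈ w, NoCrash e) → ∀ r u, A.OutputsIn (A.after inp (h ++ w)) r u →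
        u = val p₀ := by
      rintro (_ | ⟨_, w⟩) hw r u ho
      · exact absurd (by simpa using ho) (hno r u)
      · rw [List.forall_mem_cons] at hw
        obtain ⟨p, rfl⟩ := hw.1.exists_step
        rw [heq p₀ p]
        exact hval p w hw.2 r u (by simpa using ho)
    obtain ⟨w, w', r, r', u, u', hw, hw', ho, ho', hu⟩ := hb
    exact hu ((hall w hw r u ho).trans (hall w' hw' r' u' ho').symm)
  have hpq : p ≠ q := fun h => hne (h ▸ rfl)
  have hone : ∀ (h : List (Event n)) e, A.exec inp (A.after inp h) e = A.after inp (h ++ [e]) :=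
    fun h e => (after_append h [e]).symm
  have hval₂ : ∀ p q w, (∀ e ∈ w, NoCrash e) → ∀ r u,
      A.OutputsIn (A.after inp (h ++ [.step p] ++ [.step q] ++ w)) r u → u = val p :=
    fun p q w hw r u ho => hval p (.step q :: w)
      (List.forall_mem_cons.mpr ⟨noCrash_step q, hw⟩) r u (by simpa using ho)
  have hhs₂ : ∀ p q, ∀ e ∈ h ++ [Event.step p] ++ [Event.step q], NoCrash e := fun p q =>
    noCrash_append (hhs p) (noCrash_replicate q 1)
  have hconf := step_conflict (inp := inp) hpq (hno p) (hno q)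
  simp only [hone] at hconf
  rcases hconf with ⟨hN, hl⟩ | ⟨hN, hl⟩ | ⟨S, hS, hSpq, hSloc, hN⟩
  · obtain ⟨i, v, h1, h2⟩ := hA.common_output noCrash_step (hhs₂ p q) hN hl
    exact hne ((hval₂ p q _ (noCrash_replicate q i) _ _ h1).symm.trans
      (hval q _ (noCrash_replicate q i) _ _ h2))
  · obtain ⟨i, v, h1, h2⟩ := hA.common_output noCrash_step (hhs₂ q p) hN hl
    exact hne ((hval p _ (noCrash_replicate p i) _ _ h2).symm.trans
      (hval₂ q p _ (noCrash_replicate p i) _ _ h1))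
  · obtain ⟨r, hr⟩ : ∃ r, r ∉ ({p, q} : Finset (Fin n)) := by
      by_contra! hall
      have h1 := Finset.card_le_card (fun x _ => hall x : Finset.univ ⊆ ({p, q} : Finset (Fin n)))
      have h2 := Finset.card_le_two (a := p) (b := q)
      rw [Finset.card_univ, Fintype.card_fin] at h1
      omega
    rw [Finset.mem_insert, Finset.mem_singleton, not_or] at hr
    -- The third process `r` has taken no step since `h`, so it cannot distinguish the orders. With
    -- it there is one process more than there are differing elements.
    refine hne (hA.eq_of_near (S := r :: S) (List.nodup_cons.mpr ⟨fun hrS => ?_, hS⟩)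
      (Nat.lt_succ_self _) (hhs₂ p q) hN (List.forall_mem_cons.mpr ⟨?_, hSloc⟩)
      (hval₂ p q) (hval₂ q p))
    · exact (hSpq r hrS).elim hr.1 hr.2
    · rw [← hone, ← hone, ← hone, ← hone, exec_step_loc_of_ne hr.1, exec_step_loc_of_ne hr.2,
        exec_step_loc_of_ne hr.1, exec_step_loc_of_ne hr.2]


end Impossibility

/-! ### Algorithms -/

section Rank

variable {T : ObjType.{u}} {n : ℕ} {D : Type u} {A : Algorithm T n D} {inp : Fin n → D}

/-- An algorithm is wait-free if every step that is not preceded by an output of the process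
decreases a rank of its local state. -/
theorem waitFree_of_rank (rank : A.Loc → ℕ)
    (hrank : ∀ c p, (∃ v, A.OutputsIn c p v) ∨
      rank ((A.exec inp c (.step p)).loc p) < rank (c.loc p)) (σ : Schedule n) :
    A.WaitFree inp σ := by
  intro p t₀ hc hs
  by_contra! hno
  let g : ℕ → ℕ := fun t => rank ((A.configAt inp σ t).loc p)
  have hlt : ∀ t, t₀ ≤ t → σ t = .step p → g (t + 1) < g t := fun t ht hσ => by
    rcases hrank (A.configAt inp σ t) p with ⟨v, hv⟩ | h
    · exact absurd hv (hno t v ht)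
    · simpa only [g, configAt, hσ] using h
  have hle : ∀ t, t₀ ≤ t → g (t + 1) ≤ g t := fun t ht => by
    rcases hσ : σ t with q | q
    · rcases eq_or_ne p q with rfl | hq
      · exact (hlt t ht hσ).le
      · simp only [g, configAt, hσ, exec_step_loc_of_ne hq, le_refl]
    · have hq : p ≠ q := fun h => hc t ht (h ▸ hσ)
      simp [g, configAt, hσ, exec, hq]
  have hanti : ∀ s, t₀ ≤ s → ∀ t, s ≤ t → g t ≤ g s := fun s hs₀ t hst => by
    induction t, hst using Nat.le_induction with
    | base => exact le_rfl
    | succ t hst ih => exact (hle t (hs₀.trans hst)).trans ih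
  -- The rank never rises and drops infinitely often, so it would have to exceed every `N`.
  have hbound : ∀ N s, t₀ ≤ s → N ≤ g s := fun N => by
    induction N with
    | zero => exact fun _ _ => Nat.zero_le _
    | succ N ih =>
      intro s hs₀
      obtain ⟨t, hst, hσ⟩ := hs s
      have h1 := hlt t (hs₀.trans hst) hσ
      have h2 := ih (t + 1) (by omega)
      have h3 := hanti s hs₀ t hst
      omega
  exact absurd (hbound (g t₀ + 1) t₀ le_rfl) (by omega)

end Rank

section Effect

variable {T : ObjType.{u}} {n : ℕ} {D : Type u} {A : Algorithm T n D} {inp : Fin n → D}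
  {c : A.Config} {p : Fin n}

theorem exec_onObj_self {o : A.Obj} {op : T.Op} {k : T.Resp → A.Loc}
    (h : A.next p (c.loc p) = .onObj o op k) :
    (A.exec inp c (.step p)).loc p = k (T.apply (c.obj o) op).2 ∧
      (A.exec inp c (.step p)).obj o = (T.apply (c.obj o) op).1 ∧
      (A.exec inp c (.step p)).reg = c.reg := by
  simp [exec_onObj h]

theorem exec_read {r : A.Reg} {k : RegResp A.RegVal → A.Loc}
    (h : A.next p (c.loc p) = .onReg r RegOp.read k) :
    (A.exec inp c (.step p)).loc p = k (.value (c.reg r)) ∧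
      (A.exec inp c (.step p)).obj = c.obj ∧ (A.exec inp c (.step p)).reg = c.reg := by
  simp [exec_onReg h, register]

theorem exec_write {r : A.Reg} {w : A.RegVal} {k : RegResp A.RegVal → A.Loc}
    (h : A.next p (c.loc p) = .onReg r (RegOp.write w) k) :
    (A.exec inp c (.step p)).loc p = k .ack ∧ (A.exec inp c (.step p)).obj = c.obj ∧
      (A.exec inp c (.step p)).reg r = w ∧
      ∀ r', r' ≠ r → (A.exec inp c (.step p)).reg r' = c.reg r' := by
  rw [exec_onReg h]
  refine ⟨by simp [register], rfl, by simp [register], fun r' hr => ?_⟩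
  classical exact Function.update_of_ne hr ..

end Effect

/-- The algorithm for a single process that outputs its input. -/
def outputInput (T : ObjType.{u}) (D : Type u) : Algorithm T 1 D where
  Obj := PEmpty
  objInit o := o.elim
  Reg := PEmpty
  RegVal := PUnit
  regInit r := r.elim
  Loc := D
  init _ x := x
  next _ x := .output x

theorem outputInput_configAt_loc {T : ObjType.{u}} {D : Type u} (inp : Fin 1 → D) (σ : Schedule 1)
    (t : ℕ) (p : Fin 1) : ((outputInput T D).configAt inp σ t).loc p = inp p := by
  induction t with
  | zero => rfl
  | succ t ih =>
    rw [configAt]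
    rcases σ t with q | q
    · exact ih
    · simp [exec, Subsingleton.elim p q, outputInput]

theorem outputInput_solvesRC (T : ObjType.{u}) (D : Type u) : (outputInput T D).SolvesRC := by
  intro inp σ
  have hout : ∀ t p v, (outputInput T D).Outputs inp σ t p v ↔ inp p = v := fun t p v => by
    rw [Outputs, outputInput_configAt_loc]
    exact ⟨fun h => by cases h; rfl, fun h => h ▸ rfl⟩
  refine ⟨fun t t' p p' v v' h h' => ?_, fun t p v h => ⟨p, (hout t p v).mp h⟩,
    fun p t₀ _ _ => ⟨t₀, inp p, le_rfl, (hout _ _ _).mpr rfl⟩⟩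
  rw [← (hout t p v).mp h, ← (hout t' p' v').mp h', Subsingleton.elim p p']

/-- Local states of the two-process consensus algorithm: about to write the input, about to pop,
about to read the input of the other process, finished. -/
inductive PopLoc (D : Type u) : Type u
  | write (x : D)
  | pop (x : D)
  | read
  | done (v : D)

/-- The local state after a pop: only the process that obtained an element finishes. -/
def PopLoc.afterPop {V D : Type u} (x : D) : StackResp V → PopLoc D
  | .popped _ => .done x
  | _ => .read

/-- The local state after reading the input of the other process. -/
def PopLoc.afterRead {D : Type u} : RegResp D → PopLoc D
  | .value v => .done v
  | .ack => .read

/-- Two-process consensus from a stack that contains one element `a`: each process announces its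
input in its register and pops; the process that obtains `a` outputs its own input, the other
process outputs the announced input of the first one. -/
def popConsensus {V D : Type u} (a : V) (x₀ : D) : Algorithm (stack V) 2 D where
  Obj := PUnit
  objInit _ := [a]
  Reg := ULift (Fin 2)
  RegVal := D
  regInit _ := x₀
  Loc := PopLoc D
  init _ x := .write x
  next p
    | .write x => .onReg ⟨p⟩ (.write x) fun _ => .pop x
    | .pop x => .onObj .unit .pop (PopLoc.afterPop x)
    | .read => .onReg ⟨p.rev⟩ .read PopLoc.afterRead
    | .done v => .output v

variable {V D : Type u} {a : V} {x₀ : D}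

/-- The invariant of `popConsensus`: nobody has popped yet, or the stack is empty and there is a
winner whose input is the only possible output. -/
def PopInvariant (a : V) (x₀ : D) (inp : Fin 2 → D) (c : (popConsensus a x₀).Config) : Prop :=
  ((c.obj .unit : List V) = [a] ∧ ∀ p, c.loc p = PopLoc.write (inp p) ∨
    (c.loc p = PopLoc.pop (inp p) ∧ c.reg ⟨p⟩ = inp p)) ∨
  ((c.obj .unit : List V) = [] ∧ ∃ w, c.loc w = PopLoc.done (inp w) ∧ c.reg ⟨w⟩ = inp w ∧
    ∀ q, q ≠ w → c.loc q = PopLoc.write (inp q) ∨ c.loc q = PopLoc.pop (inp q) ∨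
      c.loc q = PopLoc.read ∨ c.loc q = PopLoc.done (inp w))

section Steps

variable {inp : Fin 2 → D} {c : (popConsensus a x₀).Config} {p : Fin 2}

theorem popConsensus_exec_write {x : D} (h : c.loc p = PopLoc.write x) :
    let c' := (popConsensus a x₀).exec inp c (.step p)
    c'.obj = c.obj ∧ c'.loc p = PopLoc.pop x ∧ c'.reg ⟨p⟩ = x ∧
      ∀ q, q ≠ p → c'.reg ⟨q⟩ = c.reg ⟨q⟩ := by
  have hn : (popConsensus a x₀).next p (c.loc p) =
      .onReg ⟨p⟩ (RegOp.write x) fun _ => PopLoc.pop x := by rw [h]; rfl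
  obtain ⟨hl, ho, hr, hr'⟩ := exec_write (inp := inp) hn
  exact ⟨ho, hl, hr, fun q hq => hr' _ fun h => hq (congrArg ULift.down h)⟩

theorem popConsensus_exec_pop {x : D} (h : c.loc p = PopLoc.pop x) :
    let c' := (popConsensus a x₀).exec inp c (.step p)
    c'.reg = c.reg ∧
      (((c.obj .unit : List V) = [] ∧ (c'.obj .unit : List V) = [] ∧ c'.loc p = PopLoc.read) ∨
      ∃ b, (c.obj .unit : List V) = b :: c'.obj .unit ∧ c'.loc p = PopLoc.done x) := by
  have hn : (popConsensus a x₀).next p (c.loc p) =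
      .onObj .unit StackOp.pop (PopLoc.afterPop x) := by rw [h]; rfl
  obtain ⟨hl, ho, hr⟩ := exec_onObj_self (inp := inp) hn
  refine ⟨hr, ?_⟩
  rcases hs : (c.obj .unit : List V) with _ | ⟨b, l⟩
  · rw [hs] at hl ho
    exact .inl ⟨rfl, ho, hl⟩
  · rw [hs] at hl ho
    exact .inr ⟨b, congrArg (b :: ·) ho.symm, hl⟩

theorem popConsensus_exec_read (h : c.loc p = PopLoc.read) :
    let c' := (popConsensus a x₀).exec inp c (.step p)
    c'.obj = c.obj ∧ c'.reg = c.reg ∧ c'.loc p = PopLoc.done (c.reg ⟨p.rev⟩) := by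
  have hn : (popConsensus a x₀).next p (c.loc p) =
      .onReg ⟨p.rev⟩ RegOp.read PopLoc.afterRead := by rw [h]; rfl
  obtain ⟨hl, ho, hr⟩ := exec_read (inp := inp) hn
  exact ⟨ho, hr, hl⟩

theorem popConsensus_exec_done {v : D} (h : c.loc p = PopLoc.done v) :
    (popConsensus a x₀).exec inp c (.step p) = c :=
  exec_output (v := v) (by rw [OutputsIn, h]; rfl)

/-- A process announces its input before it pops, and only the winner writes to the winner's
register. With two processes, the register that the loser reads is the winner's. -/
theorem popInvariant_exec (hc : PopInvariant a x₀ inp c) (p : Fin 2) :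
    PopInvariant a x₀ inp ((popConsensus a x₀).exec inp c (.step p)) := by
  have hne : ∀ q, q ≠ p → ((popConsensus a x₀).exec inp c (.step p)).loc q = c.loc q :=
    fun q hq => exec_step_loc_of_ne hq c
  rcases hc with ⟨hs, hl⟩ | ⟨hs, w, hw, hr, hl⟩
  · rcases hl p with hp | ⟨hp, hpr⟩
    · obtain ⟨ho, hp', hr, hr'⟩ := popConsensus_exec_write (inp := inp) hp
      refine .inl ⟨by rw [ho]; exact hs, fun q => ?_⟩
      rcases eq_or_ne q p with rfl | hq
      · exact .inr ⟨hp', hr⟩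
      · rw [hne q hq, hr' q hq]
        exact hl q
    · obtain ⟨hr, ⟨h, -⟩ | ⟨b, h, hp'⟩⟩ := popConsensus_exec_pop (inp := inp) hp
      · cases hs.symm.trans h
      · refine .inr ⟨(List.cons.inj (hs.symm.trans h)).2.symm, p, hp', by rw [hr]; exact hpr,
          fun q hq => ?_⟩
        rw [hne q hq]
        exact (hl q).elim .inl fun h => .inr (.inl h.1)
  · rcases eq_or_ne p w with rfl | hpw
    · rw [popConsensus_exec_done hw]
      exact .inr ⟨hs, p, hw, hr, hl⟩
    · have hrev : p.rev = w := (by decide : ∀ p w : Fin 2, p ≠ w → p.rev = w) p w hpw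
      have hstep : ∀ q, q ≠ w → q ≠ p →
          ((popConsensus a x₀).exec inp c (.step p)).loc q = PopLoc.write (inp q) ∨
          ((popConsensus a x₀).exec inp c (.step p)).loc q = PopLoc.pop (inp q) ∨
          ((popConsensus a x₀).exec inp c (.step p)).loc q = PopLoc.read ∨
          ((popConsensus a x₀).exec inp c (.step p)).loc q = PopLoc.done (inp w) := by
        intro q hq hqp
        rw [hne q hqp]
        exact hl q hq
      rw [← hne w hpw.symm] at hw
      rcases hl p hpw with h | h | h | h
      · obtain ⟨ho, hp', -, hr'⟩ := popConsensus_exec_write (inp := inp) h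
        refine .inr ⟨by rw [ho]; exact hs, w, hw, (hr' w hpw.symm).trans hr, fun q hq => ?_⟩
        rcases eq_or_ne q p with rfl | hqp
        · exact .inr (.inl hp')
        · exact hstep q hq hqp
      · obtain ⟨hr', ⟨-, ho, hp'⟩ | ⟨b, h, -⟩⟩ := popConsensus_exec_pop (inp := inp) h
        · refine .inr ⟨ho, w, hw, by rw [hr']; exact hr, fun q hq => ?_⟩
          rcases eq_or_ne q p with rfl | hqp
          · exact .inr (.inr (.inl hp'))
          · exact hstep q hq hqp
        · cases hs.symm.trans h
      · obtain ⟨ho, hr', hp'⟩ := popConsensus_exec_read (inp := inp) h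
        rw [hrev, hr] at hp'
        refine .inr ⟨by rw [ho]; exact hs, w, hw, by rw [hr']; exact hr, fun q hq => ?_⟩
        rcases eq_or_ne q p with rfl | hqp
        · exact .inr (.inr (.inr hp'))
        · exact hstep q hq hqp
      · rw [popConsensus_exec_done h] at hw ⊢
        exact .inr ⟨hs, w, hw, hr, hl⟩

end Steps

theorem popConsensus_solvesConsensus (a : V) (x₀ : D) :
    (popConsensus a x₀).SolvesConsensus := by
  intro inp σ hσ
  have hinv : ∀ t, PopInvariant a x₀ inp ((popConsensus a x₀).configAt inp σ t) := fun t => by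
    induction t with
    | zero => exact .inl ⟨rfl, fun p => .inl rfl⟩
    | succ t ih =>
      rw [configAt]
      rcases h : σ t with p | p
      · exact popInvariant_exec ih p
      · exact absurd h (hσ t p)
  have hdone : ∀ t p v, (popConsensus a x₀).Outputs inp σ t p v →
      ((popConsensus a x₀).configAt inp σ t).loc p = PopLoc.done v := fun t p v h => by
    unfold Outputs at h
    rcases hl : ((popConsensus a x₀).configAt inp σ t).loc p with x | x | _ | x
    all_goals rw [hl] at h; cases h
    rfl
  have hwin : ∀ t, ∃ w, ∀ p v, (popConsensus a x₀).Outputs inp σ t p v → v = inp w := fun t => by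
    rcases hinv t with ⟨-, hl⟩ | ⟨-, w, hw, -, hl⟩
    · refine ⟨0, fun p v h => ?_⟩
      have := hdone t p v h
      rcases hl p with h | ⟨h, -⟩ <;> rw [this] at h <;> cases h
    · refine ⟨w, fun p v h => ?_⟩
      have := hdone t p v h
      rcases eq_or_ne p w with rfl | hp
      · rw [this] at hw; cases hw; rfl
      · rcases hl p hp with h | h | h | h <;> rw [this] at h <;> cases h
        rfl
  have hpersist : ∀ t t' p v, t ≤ t' → (popConsensus a x₀).Outputs inp σ t p v →
      (popConsensus a x₀).Outputs inp σ t' p v := fun t t' p v htt h => by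
    obtain ⟨w, hw, hmem⟩ := firstEvents_le σ htt
    rw [Outputs, configAt_eq_after] at h ⊢
    rw [hw, after_append]
    refine outputsIn_run (fun e he => ?_) h
    obtain ⟨i, -, rfl⟩ := hmem e he
    exact hσ i p
  refine ⟨fun t t' p p' v v' h h' => ?_, fun t p v h => ?_, ?_⟩
  -- Without crashes outputs persist, so both can be compared at the later time.
  · obtain ⟨w, hw⟩ := hwin (max t t')
    rw [hw p v (hpersist _ _ _ _ (le_max_left ..) h),
      hw p' v' (hpersist _ _ _ _ (le_max_right ..) h')]
  · obtain ⟨w, hw⟩ := hwin t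
    exact ⟨w, (hw p v h).symm⟩
  · let rank : PopLoc D → ℕ := fun
      | .write _ => 3
      | .pop _ => 2
      | .read => 1
      | .done _ => 0
    refine waitFree_of_rank (A := popConsensus a x₀) rank (fun c p => ?_) σ
    rcases h : c.loc p with x | x | _ | x
    · right; rw [(popConsensus_exec_write h).2.1]; simp [rank]
    · right
      obtain ⟨-, ⟨-, -, he⟩ | ⟨b, -, he⟩⟩ := popConsensus_exec_pop (inp := inp) h <;>
        rw [he] <;> simp [rank]
    · right; rw [(popConsensus_exec_read h).2.2]; simp [rank]
    · left; exact ⟨x, by rw [OutputsIn, h]; rfl⟩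

end Algorithm

/-! ### Solvability by number of processes -/

theorem rcSolvable_one (T : ObjType.{u}) (D : Type u) : RCSolvable T D 1 :=
  ⟨_, Algorithm.outputInput_solvesRC T D⟩

theorem consensusSolvable_stack_two (V D : Type u) [Nonempty V] [Nonempty D] :
    ConsensusSolvable (stack V) D 2 :=
  ⟨_, Algorithm.popConsensus_solvesConsensus (Classical.arbitrary V) (Classical.arbitrary D)⟩

/-- Two fixed processes already yield the contradiction, whatever `n` is. Excluding all `n ≥ 2`
directly bounds the supremum without any monotonicity of solvability in `n`. -/
theorem not_rcSolvable_stack (V D : Type u) [Nontrivial D] {n : ℕ} (hn : 2 ≤ n) :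
    ¬ RCSolvable (stack V) D n := fun ⟨_, hA⟩ =>
  Algorithm.not_solvesRC_of_ne (p := ⟨0, by omega⟩) (q := ⟨1, by omega⟩) (by simp) hA

theorem not_consensusSolvable_stack (V D : Type u) [Nontrivial D] {n : ℕ} (hn : 3 ≤ n) :
    ¬ ConsensusSolvable (stack V) D n := fun ⟨_, hA⟩ => Algorithm.not_solvesConsensus hn hA

end SharedMemory

theorem mainTheorem12 {V D : Type u} [Nonempty V] [Nontrivial D] :
    ¬ SharedMemory.RCSolvable (SharedMemory.stack V) D 2 ∧
    SharedMemory.rcons (SharedMemory.stack V) D = 1 ∧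
    SharedMemory.cons (SharedMemory.stack V) D = 2 := by
  refine ⟨SharedMemory.not_rcSolvable_stack V D le_rfl, le_antisymm (sSup_le ?_) (le_sSup ?_),
    le_antisymm (sSup_le ?_) (le_sSup ?_)⟩
  · rintro _ ⟨n, rfl, h⟩
    by_contra hn
    exact SharedMemory.not_rcSolvable_stack V D (by
      have : 1 < n := by exact_mod_cast not_le.mp hn
      omega) h
  · exact ⟨1, rfl, SharedMemory.rcSolvable_one _ D⟩
  · rintro _ ⟨n, rfl, h⟩
    by_contra hn
    exact SharedMemory.not_consensusSolvable_stack V D (by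
      have : 2 < n := by exact_mod_cast not_le.mp hn
      omega) h
  · exact ⟨2, rfl, SharedMemory.consensusSolvable_stack_two V D⟩
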